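/- Let $p,q\ge 0$ be fixed integers and consider observations $x_i=Ms_i+\sqrt{\sigma}\,n_i\in\mathbb{R}^p$, $i=1,2,\dots$, where $M\in\mathbb{R}^{p\times q}$ has linearly independent columns, $\sigma>0$ is the noise variance, the noise vectors $n_i$ have the standard Gaussian distribution $\mathcal N(0,I_p)$, the signal vectors $s_i\in\mathbb{R}^q$ are identically distributed and square integrable with mean zero and positive definite covariance matrix, the pairs $(s_i,n_i)$, $i\ge 1$, are independent, and $s_i$ is independent of $n_i$ for each $i$. (In particular, the $s_i$ may be Gaussian.) Thus the true covariance matrix is $\Sigma=BB^T+\sigma I_p$ with $B\in\mathbb{R}^{p\times q}$ of rank $q$, and $q$ is the dimension of the principal subspace $\mathrm{span}(B)$. Let $\ell_1\ge\dots\ge\ell_p$ be the eigenvalues of the sample covariance matrix $S_n=\frac1n\sum_{i=1}^n x_ix_i^T$, let $(C_n)$ be a real sequence, and put $$IC(k)=\frac{n}{2\sigma^2}\sum_{i=k+1}^p(\ell_i-\sigma)^2-C_n\frac{(p-k)(p-k-1)}{2}.$$ Let $K\subseteq\{0,1,\dots,p\}$ be the set of candidate dimensions, with $q\in K$; if $q=p-1$,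 assume that $p\notin K$. For each $n$ let $\hat k=\hat k_n$ be any minimiser of $IC(k)$ over $k\in K$. If $$\lim_{n\to\infty}\frac{C_n}{n}=0\quad\text{and}\quad\lim_{n\to\infty}\frac{C_n}{\log\log n}=\infty,$$ then $\lim_{n\to\infty}\hat k_n=q$ almost surely. -/

import Mathlib

open MeasureTheory ProbabilityTheory Filter Topology

/-- The observation `x = M s + √σ z`: signal `s`, mixing matrix `M`, white noise `z`,
noise variance `σ`. -/
noncomputable def observation {p q : ℕ} (M : Matrix (Fin p) (Fin q) ℝ) (σ : ℝ)
    (s : Fin q → ℝ) (z : Fin p → ℝ) : Fin p → ℝ :=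
  M.mulVec s + Real.sqrt σ • z

/-- The sample covariance matrix `S_n = (1/n) ∑ x_i x_iᵀ` of the first `n` observations
`x 0, …, x (n - 1)`. -/
noncomputable def sampleCov {p : ℕ} (x : ℕ → Fin p → ℝ) (n : ℕ) :
    Matrix (Fin p) (Fin p) ℝ :=
  (1 / (n : ℝ)) • ∑ i ∈ Finset.range n, Matrix.vecMulVec (x i) (x i)

theorem sampleCov_isHermitian {p : ℕ} (x : ℕ → Fin p → ℝ) (n : ℕ) :
    (sampleCov x n).IsHermitian := by
  ext a b
  simp [sampleCov, Matrix.sum_apply, Matrix.vecMulVec_apply, mul_comm]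

/-- The eigenvalues of the sample covariance matrix, with multiplicity, in decreasing order
(`Matrix.IsHermitian.eigenvalues₀` is antitone). The index `i : Fin p` starts at `0`, so
`sampleEig x n i` is the `(i + 1)`-st largest eigenvalue. -/
noncomputable def sampleEig {p : ℕ} (x : ℕ → Fin p → ℝ) (n : ℕ) (i : Fin p) : ℝ :=
  (sampleCov_isHermitian x n).eigenvalues₀ (Fin.cast (Fintype.card_fin p).symm i)

/-- The criterion
`IC(k) = n / (2 σ²) * ∑_{i = k+1}^p (ℓ_i - σ)² - C * (p - k) (p - k - 1) / 2`,
where `ℓ_1 ≥ … ≥ ℓ_p` are the eigenvalues of the sample covariance matrix; in the `0`-based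
indexing of `sampleEig` the sum runs over the indices `i` with `k ≤ i`. -/
noncomputable def IC {p : ℕ} (σ C : ℝ) (x : ℕ → Fin p → ℝ) (n k : ℕ) : ℝ :=
  (n : ℝ) / (2 * σ ^ 2) *
      ∑ i : Fin p with k ≤ i.val, (sampleEig x n i - σ) ^ 2
    - C * (((p : ℝ) - (k : ℝ)) * ((p : ℝ) - (k : ℝ) - 1) / 2)

/-- The matrix of second moments `E[s sᵀ]`, which is the covariance matrix of `s` when `s` has
mean zero. -/
noncomputable def secondMoment {Ω : Type*} [MeasurableSpace Ω] (P : Measure Ω) {q : ℕ}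
    (s : Ω → Fin q → ℝ) : Matrix (Fin q) (Fin q) ℝ :=
  Matrix.of fun a b => ∫ ω, s ω a * s ω b ∂P

/-!
By Weyl's inequality the sample eigenvalues differ from those of `M (sampleCov s n) Mᵀ + σ I` by at
most the size of the cross moments of signal and noise and of the deviation of the empirical noise
covariance from `I`. These errors are `O(√(log log n / n))` almost surely. Hence an eigenvalue of
index at least `rank M` contributes `n (ℓ - σ)² = O(log log n) = o(C n)` to the criterion, and
overestimating the rank costs a positive multiple of `C n`, while an eigenvalue of index below
`rank M` tends to a limit larger than `σ`, so underestimating the rank costs order `n`, which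
dominates `C n`.

Only the upper bound of the law of the iterated logarithm is needed, and up to a constant. It
follows from the supermartingale `exp (t ∑ Y_i - t² ∑ V_i)`: Doob's maximal inequality and the
Borel–Cantelli lemma, with `t² = log k / e^k` on the block `e^k ≤ n < e^(k + 1)`, bound `∑ Y_i` by a
multiple of `√(n log log n)` as soon as `∑ V_i = O(n)`. For `Y = U G` with `G` Gaussian and
independent of `U` one takes `V = U²`, which requires only two moments of the signal.
-/

section Eigenvalues

theorem exists_ne_zero_repr_eq_zero {ι 𝕜 E : Type*} [Finite ι] [LinearOrder ι] [Field 𝕜]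
    [AddCommGroup E] [Module 𝕜 E] (b b' : Module.Basis ι 𝕜 E) (i : ι) :
    ∃ x ≠ 0, (∀ j, i < j → b.repr x j = 0) ∧ ∀ j < i, b'.repr x j = 0 := by
  have := Fintype.ofFinite ι
  have := b.finiteDimensional_of_finite
  let φ : E →ₗ[𝕜] ({j // j ≠ i} → 𝕜) :=
    LinearMap.pi fun j => if i < j.val then b.coord j else b'.coord j
  have hcard : Module.finrank 𝕜 ({j // j ≠ i} → 𝕜) < Module.finrank 𝕜 E := by
    rw [Module.finrank_fintype_fun_eq_card, Module.finrank_eq_card_basis b]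
    exact Fintype.card_subtype_lt (not_not.2 rfl)
  obtain ⟨x, hx, hx0⟩ := (Submodule.ne_bot_iff _).1 (φ.ker_ne_bot_of_finrank_lt hcard)
  refine ⟨x, hx0, fun j hj => ?_, fun j hj => ?_⟩
  · simpa [φ, hj] using congrFun (LinearMap.mem_ker.1 hx) ⟨j, hj.ne'⟩
  · simpa [φ, hj.not_gt] using congrFun (LinearMap.mem_ker.1 hx) ⟨j, hj.ne⟩

variable {𝕜 E : Type*} [RCLike 𝕜] [NormedAddCommGroup E] [InnerProductSpace 𝕜 E]
  [FiniteDimensional 𝕜 E] {n : ℕ} {S T : E →ₗ[𝕜] E}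

theorem re_inner_apply_self_eq_sum_eigenvalues (hT : T.IsSymmetric)
    (hn : Module.finrank 𝕜 E = n) (x : E) :
    RCLike.re (inner 𝕜 x (T x)) =
      ∑ i, hT.eigenvalues hn i * ‖(hT.eigenvectorBasis hn).repr x i‖ ^ 2 := by
  rw [← (hT.eigenvectorBasis hn).repr.inner_map_map, PiLp.inner_apply, map_sum]
  refine Finset.sum_congr rfl fun i _ => ?_
  rw [hT.eigenvectorBasis_apply_self_apply, RCLike.inner_apply, mul_assoc, RCLike.mul_conj,
    RCLike.re_ofReal_mul]
  norm_cast

/-- A form of Weyl's monotonicity principle. -/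
theorem eigenvalues_add_le_eigenvalues (hS : S.IsSymmetric) (hT : T.IsSymmetric)
    (hn : Module.finrank 𝕜 E = n) {c : ℝ}
    (h : ∀ x, RCLike.re (inner 𝕜 x (S x)) + c * ‖x‖ ^ 2 ≤ RCLike.re (inner 𝕜 x (T x)))
    (i : Fin n) : hS.eigenvalues hn i + c ≤ hT.eigenvalues hn i := by
  obtain ⟨x, hx0, hSx, hTx⟩ := exists_ne_zero_repr_eq_zero
    (hS.eigenvectorBasis hn).toBasis (hT.eigenvectorBasis hn).toBasis i
  simp only [OrthonormalBasis.coe_toBasis_repr_apply] at hSx hTx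
  have norm_sq_eq (b : OrthonormalBasis (Fin n) 𝕜 E) : ‖x‖ ^ 2 = ∑ j, ‖b.repr x j‖ ^ 2 := by
    rw [← EuclideanSpace.norm_sq_eq, b.repr.norm_map]
  have lower : hS.eigenvalues hn i * ‖x‖ ^ 2 ≤ RCLike.re (inner 𝕜 x (S x)) := by
    rw [norm_sq_eq (hS.eigenvectorBasis hn), re_inner_apply_self_eq_sum_eigenvalues hS hn,
      Finset.mul_sum]
    refine Finset.sum_le_sum fun j _ => ?_
    rcases lt_or_ge i j with hij | hji
    · simp [hSx j hij]
    · exact mul_le_mul_of_nonneg_right (hS.eigenvalues_antitone hn hji) (sq_nonneg _)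
  have upper : RCLike.re (inner 𝕜 x (T x)) ≤ hT.eigenvalues hn i * ‖x‖ ^ 2 := by
    rw [norm_sq_eq (hT.eigenvectorBasis hn), re_inner_apply_self_eq_sum_eigenvalues hT hn,
      Finset.mul_sum]
    refine Finset.sum_le_sum fun j _ => ?_
    rcases lt_or_ge j i with hji | hij
    · simp [hTx j hji]
    · exact mul_le_mul_of_nonneg_right (hT.eigenvalues_antitone hn hij) (sq_nonneg _)
  have hpos : 0 < ‖x‖ ^ 2 := by positivity
  refine le_of_mul_le_mul_right ?_ hpos
  linarith [h x]

end Eigenvalues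

section SymmetricMatrix

open Matrix

variable {m : Type*} [Fintype m]

theorem abs_dotProduct_mulVec_le (E : Matrix m m ℝ) (y : m → ℝ) :
    |y ⬝ᵥ E *ᵥ y| ≤ (∑ a, ∑ b, |E a b|) * (y ⬝ᵥ y) := by
  have hsq (a : m) : |y a| ^ 2 ≤ y ⬝ᵥ y := by
    rw [sq_abs, sq]
    exact Finset.single_le_sum (f := fun b => y b * y b) (fun b _ => mul_self_nonneg _)
      (Finset.mem_univ a)
  have hprod (a b : m) : |y a| * |y b| ≤ y ⬝ᵥ y := by
    linarith [hsq a, hsq b, two_mul_le_add_sq |y a| |y b|]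
  calc |y ⬝ᵥ E *ᵥ y| = |∑ a, ∑ b, E a b * (y a * y b)| := by
        simp only [dotProduct, mulVec, Finset.mul_sum, mul_left_comm]
    _ ≤ ∑ a, ∑ b, |E a b * (y a * y b)| :=
        (Finset.abs_sum_le_sum_abs _ _).trans
          (Finset.sum_le_sum fun _ _ => Finset.abs_sum_le_sum_abs _ _)
    _ ≤ ∑ a, ∑ b, |E a b| * (y ⬝ᵥ y) := by
        simp only [abs_mul]
        gcongr with a _ b _
        exact hprod a b
    _ = (∑ a, ∑ b, |E a b|) * (y ⬝ᵥ y) := by simp only [Finset.sum_mul]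

open scoped MatrixOrder Matrix.Norms.L2Operator in
theorem rank_mul_mul_transpose_of_posDef {k : Type*} [Fintype k] {Γ : Matrix m m ℝ}
    (hΓ : Γ.PosDef) (M : Matrix k m ℝ) : (M * Γ * Mᵀ).rank = M.rank := by
  classical
  obtain ⟨B, hB, rfl⟩ :=
    CStarAlgebra.isStrictlyPositive_iff_eq_mul_star_self.1 hΓ.isStrictlyPositive
  rw [star_eq_conjTranspose, conjTranspose_eq_transpose_of_trivial, ← Matrix.mul_assoc,
    Matrix.mul_assoc (M * B), ← transpose_mul, rank_self_mul_transpose,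
    rank_mul_eq_left_of_isUnit_det _ _ ((isUnit_iff_isUnit_det B).1 hB)]

variable [DecidableEq m] {A B : Matrix m m ℝ}

theorem eigenvalues₀_add_le_eigenvalues₀ (hA : A.IsHermitian) (hB : B.IsHermitian) {c : ℝ}
    (h : ∀ y, y ⬝ᵥ A *ᵥ y + c * (y ⬝ᵥ y) ≤ y ⬝ᵥ B *ᵥ y) (i : Fin (Fintype.card m)) :
    hA.eigenvalues₀ i + c ≤ hB.eigenvalues₀ i := by
  refine eigenvalues_add_le_eigenvalues _ _ _ (fun x => ?_) i
  have norm_sq : ‖x‖ ^ 2 = x.ofLp ⬝ᵥ x.ofLp := by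
    simp only [EuclideanSpace.real_norm_sq_eq, dotProduct, ← sq]
  have inner_eq (D : Matrix m m ℝ) :
      RCLike.re (inner ℝ x (D.toEuclideanLin x)) = x.ofLp ⬝ᵥ D *ᵥ x.ofLp := by
    simp [EuclideanSpace.inner_eq_star_dotProduct, dotProduct_comm]
  rw [norm_sq, inner_eq, inner_eq]
  exact h x.ofLp

theorem abs_eigenvalues₀_sub_le {E : Matrix m m ℝ} {c : ℝ} (hA : A.IsHermitian)
    (hB : B.IsHermitian) (hE : A = B + c • 1 + E) (i : Fin (Fintype.card m)) :
    |hA.eigenvalues₀ i - (hB.eigenvalues₀ i + c)| ≤ ∑ a, ∑ b, |E a b| := by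
  set δ := ∑ a, ∑ b, |E a b|
  have hquad (y : m → ℝ) : y ⬝ᵥ A *ᵥ y = y ⬝ᵥ B *ᵥ y + c * (y ⬝ᵥ y) + y ⬝ᵥ E *ᵥ y := by
    rw [hE, add_mulVec, add_mulVec, smul_mulVec, one_mulVec, dotProduct_add, dotProduct_add,
      dotProduct_smul, smul_eq_mul]
  have hδ (y : m → ℝ) := abs_le.1 (abs_dotProduct_mulVec_le E y)
  have upper : hA.eigenvalues₀ i + -(c + δ) ≤ hB.eigenvalues₀ i :=
    eigenvalues₀_add_le_eigenvalues₀ hA hB (fun y => by linarith [hquad y, (hδ y).2]) i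
  have lower : hB.eigenvalues₀ i + (c - δ) ≤ hA.eigenvalues₀ i :=
    eigenvalues₀_add_le_eigenvalues₀ hB hA (fun y => by linarith [hquad y, (hδ y).1]) i
  rw [abs_le]
  constructor <;> linarith

theorem rank_eq_card_eigenvalues₀_pos (hA : A.PosSemidef) :
    A.rank = Fintype.card {i // 0 < hA.isHermitian.eigenvalues₀ i} := by
  rw [hA.isHermitian.rank_eq_card_non_zero_eigs]
  refine Fintype.card_congr (Equiv.subtypeEquiv (Fintype.equivOfCardEq (Fintype.card_fin _)).symm
    fun i => ?_)
  exact (hA.eigenvalues_nonneg i).lt_iff_ne'.symm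

theorem eigenvalues₀_pos_iff_lt_rank (hA : A.PosSemidef) (i : Fin (Fintype.card m)) :
    0 < hA.isHermitian.eigenvalues₀ i ↔ i.val < A.rank := by
  have anti := hA.isHermitian.eigenvalues₀_antitone
  rw [rank_eq_card_eigenvalues₀_pos hA, Fintype.card_subtype]
  refine ⟨fun hi => ?_, fun hi => ?_⟩
  · have : Finset.Iic i ⊆ ({j | 0 < hA.isHermitian.eigenvalues₀ j} : Finset _) := fun j hj => by
      simpa using hi.trans_le (anti (Finset.mem_Iic.1 hj))
    simpa using Finset.card_le_card this
  · by_contra! hi0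
    have : ({j | 0 < hA.isHermitian.eigenvalues₀ j} : Finset _) ⊆ Finset.Iio i := fun j hj => by
      rw [Finset.mem_Iio, ← not_le]
      exact fun hij => ((Finset.mem_filter.1 hj).2.trans_le (anti hij)).not_ge hi0
    exact hi.not_ge (by simpa using Finset.card_le_card this)

theorem eigenvalues₀_eq_zero_of_rank_le (hA : A.PosSemidef) {i : Fin (Fintype.card m)}
    (hi : A.rank ≤ i) : hA.isHermitian.eigenvalues₀ i = 0 := by
  have hnonneg : 0 ≤ hA.isHermitian.eigenvalues₀ i := by
    simpa [IsHermitian.eigenvalues] using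
      hA.eigenvalues_nonneg (Fintype.equivOfCardEq (Fintype.card_fin _) i)
  exact hnonneg.antisymm' (not_lt.1 fun h => hi.not_gt ((eigenvalues₀_pos_iff_lt_rank hA i).1 h))

end SymmetricMatrix

section SampleCovariance

open Matrix Asymptotics

/-- The empirical cross moment matrix `(1/n) ∑ u_i v_iᵀ` of the first `n` terms of two sequences
of vectors. -/
noncomputable def sampleCrossMoment {p q : ℕ} (u : ℕ → Fin p → ℝ) (v : ℕ → Fin q → ℝ) (n : ℕ) :
    Matrix (Fin p) (Fin q) ℝ :=
  (1 / (n : ℝ)) • ∑ i ∈ Finset.range n, vecMulVec (u i) (v i)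

theorem sampleCrossMoment_apply {p q : ℕ} (u : ℕ → Fin p → ℝ) (v : ℕ → Fin q → ℝ) (n : ℕ)
    (a : Fin p) (b : Fin q) :
    sampleCrossMoment u v n a b = (∑ i ∈ Finset.range n, u i a * v i b) / n := by
  simp only [sampleCrossMoment, Matrix.smul_apply, Matrix.sum_apply, vecMulVec_apply, smul_eq_mul,
    one_div_mul_eq_div]

theorem sampleCov_apply {p : ℕ} (x : ℕ → Fin p → ℝ) (n : ℕ) (a b : Fin p) :
    sampleCov x n a b = (∑ i ∈ Finset.range n, x i a * x i b) / n :=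
  sampleCrossMoment_apply x x n a b

theorem posSemidef_sampleCov {p : ℕ} (x : ℕ → Fin p → ℝ) (n : ℕ) : (sampleCov x n).PosSemidef :=
  (posSemidef_sum _ fun i _ => posSemidef_vecMulVec_self_star (x i)).smul (by positivity)

variable {p q : ℕ} (M : Matrix (Fin p) (Fin q) ℝ) (σ : ℝ)

theorem vecMulVec_observation (hσ : 0 ≤ σ) (s : Fin q → ℝ) (z : Fin p → ℝ) :
    vecMulVec (observation M σ s z) (observation M σ s z) =
      M * vecMulVec s s * Mᵀ + √σ • (M * vecMulVec s z + (M * vecMulVec s z)ᵀ) +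
        σ • vecMulVec z z := by
  have hσσ : √σ • √σ • vecMulVec z z = σ • vecMulVec z z := by
    rw [smul_smul, Real.mul_self_sqrt hσ]
  simp only [observation, vecMulVec_add, add_vecMulVec, vecMulVec_smul, smul_vecMulVec,
    mul_vecMulVec, vecMulVec_mul, vecMul_transpose, transpose_vecMulVec, hσσ, smul_add]
  abel

/-- The deviation of the sample covariance matrix of the observations from
`M (sampleCov s n) Mᵀ + σ I`. -/
noncomputable def noiseError (s : ℕ → Fin q → ℝ) (z : ℕ → Fin p → ℝ) (n : ℕ) :
    Matrix (Fin p) (Fin p) ℝ :=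
  √σ • (M * sampleCrossMoment s z n + (M * sampleCrossMoment s z n)ᵀ) + σ • (sampleCov z n - 1)

variable (s : ℕ → Fin q → ℝ) (z : ℕ → Fin p → ℝ)

theorem sampleCov_observation (hσ : 0 ≤ σ) (n : ℕ) :
    sampleCov (fun i => observation M σ (s i) (z i)) n =
      M * sampleCov s n * Mᵀ + σ • 1 + noiseError M σ s z n := by
  simp only [sampleCov, noiseError, sampleCrossMoment, vecMulVec_observation M σ hσ,
    Finset.sum_add_distrib, ← Finset.smul_sum, Matrix.mul_sum, Matrix.sum_mul, transpose_sum,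
    transpose_smul, Matrix.mul_smul, Matrix.smul_mul, smul_add, smul_sub,
    smul_comm (1 / (n : ℝ))]
  abel

variable {M σ s z}

theorem isBigO_noiseError {ρ : ℕ → ℝ}
    (hcross : ∀ a b, (fun n => sampleCrossMoment s z n a b) =O[atTop] ρ)
    (hnoise : ∀ a b, (fun n => (sampleCov z n - 1) a b) =O[atTop] ρ) (a b : Fin p) :
    (fun n => noiseError M σ s z n a b) =O[atTop] ρ := by
  have hM (a b : Fin p) : (fun n => (M * sampleCrossMoment s z n) a b) =O[atTop] ρ := by
    simp only [mul_apply]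
    exact IsBigO.fun_sum fun j _ => (hcross j b).const_mul_left _
  exact (((hM a b).add (hM b a)).const_mul_left _).add ((hnoise a b).const_mul_left _)

theorem isBigO_sampleEig_sub_of_rank_le (hσ : 0 ≤ σ) {ρ : ℕ → ℝ}
    (herror : ∀ a b, (fun n => noiseError M σ s z n a b) =O[atTop] ρ)
    {i : Fin p} (hi : M.rank ≤ i) :
    (fun n => sampleEig (fun i => observation M σ (s i) (z i)) n i - σ) =O[atTop] ρ := by
  have hsum : (fun n => ∑ a, ∑ b, |noiseError M σ s z n a b|) =O[atTop] ρ :=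
    IsBigO.fun_sum fun a _ => IsBigO.fun_sum fun b _ => (herror a b).abs_left
  refine (IsBigO.of_bound' (Eventually.of_forall fun n => ?_)).trans hsum
  have hpsd : (M * sampleCov s n * Mᵀ).PosSemidef :=
    (posSemidef_sampleCov s n).mul_mul_conjTranspose_same M
  have hrank : (M * sampleCov s n * Mᵀ).rank ≤ M.rank := by
    rw [Matrix.mul_assoc]
    exact rank_mul_le_left M _
  have h := abs_eigenvalues₀_sub_le (sampleCov_isHermitian _ n) hpsd.isHermitian
    (sampleCov_observation M σ s z hσ n) (Fin.cast (Fintype.card_fin p).symm i)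
  rw [eigenvalues₀_eq_zero_of_rank_le hpsd (hrank.trans hi), zero_add] at h
  exact h.trans (le_abs_self _)

theorem exists_tendsto_sampleEig_of_lt_rank (hσ : 0 ≤ σ) {Γ : Matrix (Fin q) (Fin q) ℝ}
    (hΓ : Γ.PosDef) (hs : Tendsto (sampleCov s) atTop (𝓝 Γ))
    (herror : Tendsto (noiseError M σ s z) atTop (𝓝 0)) {i : Fin p} (hi : i.val < M.rank) :
    ∃ l > σ, Tendsto (fun n => sampleEig (fun i => observation M σ (s i) (z i)) n i) atTop
      (𝓝 l) := by
  have hpsd : (M * Γ * Mᵀ).PosSemidef := hΓ.posSemidef.mul_mul_conjTranspose_same M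
  set i' : Fin (Fintype.card (Fin p)) := Fin.cast (Fintype.card_fin p).symm i
  have hpos : 0 < hpsd.isHermitian.eigenvalues₀ i' := by
    rwa [eigenvalues₀_pos_iff_lt_rank hpsd, rank_mul_mul_transpose_of_posDef hΓ]
  refine ⟨hpsd.isHermitian.eigenvalues₀ i' + σ, by linarith, ?_⟩
  let E (n : ℕ) := M * (sampleCov s n - Γ) * Mᵀ + noiseError M σ s z n
  have hE (n : ℕ) : sampleCov (fun i => observation M σ (s i) (z i)) n =
      M * Γ * Mᵀ + σ • 1 + E n := by
    simp only [sampleCov_observation M σ s z hσ, E, Matrix.mul_sub, Matrix.sub_mul]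
    abel
  have hE0 : Tendsto E atTop (𝓝 0) := by
    have hmul : Continuous fun D : Matrix (Fin q) (Fin q) ℝ => M * (D - Γ) * Mᵀ := by fun_prop
    simpa using ((hmul.tendsto Γ).comp hs).add herror
  have hsum : Continuous fun D : Matrix (Fin p) (Fin p) ℝ => ∑ a, ∑ b, |D a b| := by fun_prop
  rw [tendsto_iff_norm_sub_tendsto_zero]
  refine squeeze_zero (fun n => norm_nonneg _)
    (fun n => abs_eigenvalues₀_sub_le (sampleCov_isHermitian _ n) _ (hE n) i') ?_
  simpa [Function.comp_def] using (hsum.tendsto 0).comp hE0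

end SampleCovariance

section InformationCriterion

open Asymptotics

variable {p : ℕ} {σ : ℝ} {x : ℕ → Fin p → ℝ} {C : ℕ → ℝ}

theorem IC_sub_IC {j k : ℕ} (hjk : j ≤ k) (σ c : ℝ) (x : ℕ → Fin p → ℝ) (n : ℕ) :
    IC σ c x n k - IC σ c x n j =
      c * (((k : ℝ) - j) * (2 * p - j - k - 1) / 2) -
        n / (2 * σ ^ 2) * ∑ i : Fin p with j ≤ i.val ∧ i.val < k, (sampleEig x n i - σ) ^ 2 := by
  have hsplit : ∑ i : Fin p with j ≤ i.val, (sampleEig x n i - σ) ^ 2 =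
      ∑ i : Fin p with j ≤ i.val ∧ i.val < k, (sampleEig x n i - σ) ^ 2 +
        ∑ i : Fin p with k ≤ i.val, (sampleEig x n i - σ) ^ 2 := by
    rw [← Finset.sum_filter_add_sum_filter_not _ (fun i : Fin p => i.val < k),
      Finset.filter_filter, Finset.filter_filter]
    congr! 4 with i
    omega
  rw [IC, IC, hsplit]
  ring

theorem eventually_IC_lt_of_lt_of_tendsto (hσ : 0 < σ) {k q : ℕ} (hkq : k < q) (hkp : k < p)
    {l : ℝ} (hl : l ≠ σ) (hlim : Tendsto (fun n => sampleEig x n ⟨k, hkp⟩) atTop (𝓝 l))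
    (hC : Tendsto (fun n : ℕ => C n / (n : ℝ)) atTop (𝓝 0)) :
    ∀ᶠ n in atTop, IC σ (C n) x n q < IC σ (C n) x n k := by
  set b : ℝ := ((q : ℝ) - k) * (2 * p - k - q - 1) / 2
  have hgap : 0 < 1 / (2 * σ ^ 2) * (l - σ) ^ 2 := by
    have := sub_ne_zero.2 hl
    positivity
  have hlt : ∀ᶠ n : ℕ in atTop,
      C n / n * b < 1 / (2 * σ ^ 2) * (sampleEig x n ⟨k, hkp⟩ - σ) ^ 2 := by
    refine (hC.mul_const b).eventually_lt (((hlim.sub_const σ).pow 2).const_mul _) ?_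
    rwa [zero_mul]
  filter_upwards [hlt, eventually_gt_atTop 0] with n hn hn0
  have : (0 : ℝ) < n := Nat.cast_pos.2 hn0
  have hle : (sampleEig x n ⟨k, hkp⟩ - σ) ^ 2 ≤
      ∑ i : Fin p with k ≤ i.val ∧ i.val < q, (sampleEig x n i - σ) ^ 2 :=
    Finset.single_le_sum (f := fun i => (sampleEig x n i - σ) ^ 2) (fun _ _ => sq_nonneg _)
      (Finset.mem_filter.2 ⟨Finset.mem_univ _, le_rfl, hkq⟩)
  rw [← sub_neg, IC_sub_IC hkq.le, sub_neg]
  calc C n * b = n * (C n / n * b) := by field_simp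
    _ < n * (1 / (2 * σ ^ 2) * (sampleEig x n ⟨k, hkp⟩ - σ) ^ 2) := by gcongr
    _ = n / (2 * σ ^ 2) * (sampleEig x n ⟨k, hkp⟩ - σ) ^ 2 := by ring
    _ ≤ _ := by gcongr

theorem eventually_IC_lt_of_gt_of_isLittleO {q k : ℕ} (hqk : q < k) (hkp : k ≤ p)
    (hne : ¬(q + 1 = p ∧ k = p))
    (hsmall : ∀ i : Fin p, q ≤ i.val →
      (fun n : ℕ => n * (sampleEig x n i - σ) ^ 2) =o[atTop] C)
    (hC : ∀ᶠ n in atTop, 0 < C n) :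
    ∀ᶠ n in atTop, IC σ (C n) x n q < IC σ (C n) x n k := by
  set b : ℝ := ((k : ℝ) - q) * (2 * p - q - k - 1) / 2
  have hb : 0 < b := by
    have h1 : (q : ℝ) + 1 ≤ k := by exact_mod_cast hqk
    have h2 : (q : ℝ) + k + 2 ≤ 2 * p := by exact_mod_cast (by omega : q + k + 2 ≤ 2 * p)
    exact div_pos (mul_pos (by linarith) (by linarith)) two_pos
  have hsum : (fun n : ℕ => 1 / (2 * σ ^ 2) * ∑ i : Fin p with q ≤ i.val ∧ i.val < k,
      n * (sampleEig x n i - σ) ^ 2) =o[atTop] C :=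
    (IsLittleO.fun_sum fun i hi => hsmall i (Finset.mem_filter.1 hi).2.1).const_mul_left _
  filter_upwards [hsum.def (half_pos hb), hC] with n hn hCn
  rw [Real.norm_of_nonneg hCn.le, ← Finset.mul_sum] at hn
  rw [← sub_pos, IC_sub_IC hqk.le, sub_pos]
  calc _ = 1 / (2 * σ ^ 2) * (n * ∑ i : Fin p with q ≤ i.val ∧ i.val < k,
        (sampleEig x n i - σ) ^ 2) := by ring
    _ ≤ b / 2 * C n := (le_abs_self _).trans hn
    _ < C n * b := by nlinarith [mul_pos hb hCn]

theorem tendsto_of_eventually_lt_of_forall_le {α ι β : Type*} [TopologicalSpace ι] [Preorder β]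
    {l : Filter α} {f : α → ι → β} {K : Finset ι} {khat : α → ι} {q : ι}
    (h_mem : ∀ n, khat n ∈ K) (h_min : ∀ n, f n (khat n) ≤ f n q)
    (h : ∀ k ∈ K, k ≠ q → ∀ᶠ n in l, f n q < f n k) : Tendsto khat l (𝓝 q) := by
  have hall : ∀ᶠ n in l, ∀ k ∈ K, k ≠ q → f n q < f n k := by
    simpa only [Finset.eventually_all, eventually_imp_distrib_left] using h
  refine tendsto_nhds_of_eventually_eq (hall.mono fun n hn => ?_)
  by_contra hne
  exact (hn _ (h_mem n) hne).not_ge (h_min n)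

end InformationCriterion

section MaximalInequality

variable {Ω : Type*} [MeasurableSpace Ω] {P : Measure Ω}

theorem integrable_prod_range_of_iIndepFun [IsProbabilityMeasure P] {W : ℕ → Ω → ℝ}
    (hm : ∀ i, Measurable (W i)) (hind : iIndepFun W P) (hint : ∀ i, Integrable (W i) P) (n : ℕ) :
    Integrable (∏ i ∈ Finset.range n, W i) P := by
  induction n with
  | zero => exact integrable_const 1
  | succ n ih =>
    rw [Finset.prod_range_succ]
    exact (hind.indepFun_prod_range_succ hm n).integrable_mul ih (hint n)

theorem martingale_prod_range_succ [IsProbabilityMeasure P] {W : ℕ → Ω → ℝ}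
    (hm : ∀ i, StronglyMeasurable (W i)) (hind : iIndepFun W P) (hint : ∀ i, Integrable (W i) P)
    (hmean : ∀ i, ∫ ω, W i ω ∂P = 1) :
    Martingale (fun n => ∏ i ∈ Finset.range (n + 1), W i) (Filtration.natural W hm) P := by
  have hprod := integrable_prod_range_of_iIndepFun (fun i => (hm i).measurable) hind hint
  have hadapted : StronglyAdapted (Filtration.natural W hm)
      fun n => ∏ i ∈ Finset.range (n + 1), W i := fun n =>
    Finset.stronglyMeasurable_prod _ fun i hi => (Filtration.stronglyAdapted_natural hm i).mono
      ((Filtration.natural W hm).mono (Finset.mem_range_succ_iff.1 hi))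
  refine martingale_nat hadapted (fun n => hprod (n + 1)) fun n => ?_
  have hsucc := Finset.prod_range_succ W (n + 1)
  have hpull := condExp_mul_of_stronglyMeasurable_left (μ := P) (hadapted n)
    (hsucc ▸ hprod (n + 2)) (hint (n + 1))
  rw [hsucc]
  filter_upwards [hpull, hind.condExp_natural_ae_eq_of_lt hm n.lt_succ_self] with ω hω hω'
  rw [hω, Pi.mul_apply, hω', hmean, mul_one]

theorem measure_exists_le_prod_le [IsProbabilityMeasure P] {W : ℕ → Ω → ℝ}
    (hm : ∀ i, StronglyMeasurable (W i)) (hnonneg : ∀ i ω, 0 ≤ W i ω) (hind : iIndepFun W P)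
    (hint : ∀ i, Integrable (W i) P) (hmean : ∀ i, ∫ ω, W i ω ∂P = 1) (N : ℕ) {a : ℝ}
    (ha : 0 < a) :
    P {ω | ∃ n ≤ N, a ≤ ∏ i ∈ Finset.range (n + 1), W i ω} ≤ ENNReal.ofReal a⁻¹ := by
  have hmart := martingale_prod_range_succ hm hind hint hmean
  have hprod (n : ℕ) : 0 ≤ ∏ i ∈ Finset.range (n + 1), W i := fun ω => by
    simpa using Finset.prod_nonneg fun i _ => hnonneg i ω
  have hmax := maximal_ineq hmart.submartingale hprod (ε := a.toNNReal) N
  set A := {ω | (a.toNNReal : ℝ) ≤ (Finset.range (N + 1)).sup' Finset.nonempty_range_add_one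
    fun k => (∏ i ∈ Finset.range (k + 1), W i) ω}
  have hA : {ω | ∃ n ≤ N, a ≤ ∏ i ∈ Finset.range (n + 1), W i ω} = A := by
    ext ω
    simp [A, Real.coe_toNNReal _ ha.le, Finset.le_sup'_iff]
  have hle : ∫ ω in A, (∏ i ∈ Finset.range (N + 1), W i) ω ∂P ≤ 1 := by
    calc _ ≤ ∫ ω, (∏ i ∈ Finset.range (N + 1), W i) ω ∂P :=
          setIntegral_le_integral (hmart.integrable N) (ae_of_all _ (hprod N))
      _ = ∫ ω, (∏ i ∈ Finset.range (0 + 1), W i) ω ∂P := by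
          simpa using (hmart.setIntegral_eq N.zero_le MeasurableSet.univ).symm
      _ = 1 := by simp [hmean]
  rw [hA, ENNReal.ofReal_inv_of_pos ha, ← one_div, ENNReal.le_div_iff_mul_le (by simp [ha])
    (by simp), mul_comm]
  exact hmax.trans (ENNReal.ofReal_le_one.2 hle)

theorem measure_exists_le_sum_le_of_measurable [IsProbabilityMeasure P] {X : ℕ → Ω → ℝ}
    (hm : ∀ i, Measurable (X i)) (hind : iIndepFun X P)
    (hexp : ∀ i, ∫⁻ ω, ENNReal.ofReal (Real.exp (X i ω)) ∂P ≤ 1) (N : ℕ) (a : ℝ) :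
    P {ω | ∃ n ≤ N, a ≤ ∑ i ∈ Finset.range (n + 1), X i ω} ≤ ENNReal.ofReal (Real.exp (-a)) := by
  have hexp_nonneg (i : ℕ) : 0 ≤ᵐ[P] fun ω => Real.exp (X i ω) :=
    ae_of_all _ fun ω => (Real.exp_pos _).le
  have hint (i : ℕ) : Integrable (fun ω => Real.exp (X i ω)) P := by
    refine ⟨(hm i).exp.aestronglyMeasurable, ?_⟩
    rw [hasFiniteIntegral_iff_ofReal (hexp_nonneg i)]
    exact (hexp i).trans_lt ENNReal.one_lt_top
  let c (i : ℕ) : ℝ := ∫ ω, Real.exp (X i ω) ∂P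
  have hc_pos (i : ℕ) : 0 < c i := integral_exp_pos (hint i)
  have hc_le (i : ℕ) : c i ≤ 1 := by
    rw [← ENNReal.ofReal_le_one, ofReal_integral_eq_lintegral_ofReal (hint i) (hexp_nonneg i)]
    exact hexp i
  have hprod := measure_exists_le_prod_le (P := P) (W := fun i ω => Real.exp (X i ω) / c i)
    (fun i => ((hm i).exp.div_const (c i)).stronglyMeasurable)
    (fun i ω => div_nonneg (Real.exp_pos _).le (hc_pos i).le)
    (hind.comp (fun i x => Real.exp x / c i) fun i => Real.measurable_exp.div_const _)
    (fun i => (hint i).div_const _)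
    (fun i => by rw [integral_div]; exact div_self (hc_pos i).ne') N (Real.exp_pos a)
  rw [Real.exp_neg]
  refine (measure_mono ?_).trans hprod
  rintro ω ⟨n, hn, h⟩
  refine ⟨n, hn, ?_⟩
  calc Real.exp a ≤ ∏ i ∈ Finset.range (n + 1), Real.exp (X i ω) := by
        rwa [← Real.exp_sum, Real.exp_le_exp]
    _ ≤ ∏ i ∈ Finset.range (n + 1), Real.exp (X i ω) / c i :=
        Finset.prod_le_prod (fun i _ => (Real.exp_pos _).le) fun i _ =>
          le_div_self (Real.exp_pos _).le (hc_pos i) (hc_le i)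

theorem measure_exists_le_sum_le [IsProbabilityMeasure P] {X : ℕ → Ω → ℝ}
    (hm : ∀ i, AEMeasurable (X i) P) (hind : iIndepFun X P)
    (hexp : ∀ i, ∫⁻ ω, ENNReal.ofReal (Real.exp (X i ω)) ∂P ≤ 1) (N : ℕ) (a : ℝ) :
    P {ω | ∃ n ≤ N, a ≤ ∑ i ∈ Finset.range (n + 1), X i ω} ≤ ENNReal.ofReal (Real.exp (-a)) := by
  have hae (i : ℕ) : X i =ᵐ[P] (hm i).mk := (hm i).ae_eq_mk
  refine (measure_mono_ae ?_).trans (measure_exists_le_sum_le_of_measurable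
    (fun i => (hm i).measurable_mk) (hind.congr hae) (fun i => ?_) N a)
  · filter_upwards [ae_all_iff.2 hae] with ω hω
    rintro ⟨n, hn, h⟩
    exact ⟨n, hn, by simpa only [hω] using h⟩
  · refine (lintegral_congr_ae ?_).trans_le (hexp i)
    filter_upwards [hae i] with ω hω
    rw [hω]

end MaximalInequality

section IteratedLogarithm

open Asymptotics

variable {Ω : Type*} [MeasurableSpace Ω] {P : Measure Ω}

/-- The canonical assumption of the theory of self-normalised sums, in local form:
`exp (t Y - t² V)` has mean at most one for `|t| ≤ t₀`. The random variable `V` serves as a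
variance proxy for `Y`. -/
structure IsCanonicalPair (P : Measure Ω) (t₀ : ℝ) (Y V : Ω → ℝ) : Prop where
  aemeasurable_fst : AEMeasurable Y P
  aemeasurable_snd : AEMeasurable V P
  lintegral_exp_le_one : ∀ t, |t| ≤ t₀ →
    ∫⁻ ω, ENNReal.ofReal (Real.exp (t * Y ω - t ^ 2 * V ω)) ∂P ≤ 1

variable [IsProbabilityMeasure P] {t₀ : ℝ} {Y V : ℕ → Ω → ℝ}

theorem ae_eventually_forall_sum_lt (hYV : ∀ i, IsCanonicalPair P t₀ (Y i) (V i))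
    (hind : iIndepFun (fun i ω => (Y i ω, V i ω)) P) {t x : ℕ → ℝ}
    (ht : ∀ᶠ k in atTop, |t k| ≤ t₀) (hx : Summable fun k => Real.exp (-x k)) (N : ℕ → ℕ) :
    ∀ᵐ ω ∂P, ∀ᶠ k in atTop, ∀ n ≤ N k,
      ∑ i ∈ Finset.range (n + 1), (t k * Y i ω - t k ^ 2 * V i ω) < x k := by
  let A (k : ℕ) : Set Ω := {ω | |t k| ≤ t₀ ∧ ∃ n ≤ N k,
    x k ≤ ∑ i ∈ Finset.range (n + 1), (t k * Y i ω - t k ^ 2 * V i ω)}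
  have hA (k : ℕ) : P (A k) ≤ ENNReal.ofReal (Real.exp (-x k)) := by
    by_cases htk : |t k| ≤ t₀
    · refine (measure_mono fun ω hω => hω.2).trans (measure_exists_le_sum_le (fun i => ?_)
        (hind.comp (fun _ y => t k * y.1 - t k ^ 2 * y.2) fun _ => by fun_prop)
        (fun i => (hYV i).lintegral_exp_le_one (t k) htk) (N k) (x k))
      exact ((hYV i).aemeasurable_fst.const_mul _).sub ((hYV i).aemeasurable_snd.const_mul _)
    · simp [A, htk]
  have hsum : ∑' k, P (A k) ≠ ⊤ :=
    ne_top_of_le_ne_top hx.tsum_ofReal_ne_top (ENNReal.tsum_le_tsum hA)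
  filter_upwards [ae_eventually_notMem hsum] with ω hω
  filter_upwards [hω, ht] with k hk htk n hn
  by_contra! hle
  exact hk ⟨htk, n, hn, hle⟩

theorem ae_eventually_forall_abs_mul_sum_lt (hYV : ∀ i, IsCanonicalPair P t₀ (Y i) (V i))
    (hind : iIndepFun (fun i ω => (Y i ω, V i ω)) P) {t x : ℕ → ℝ}
    (ht : ∀ᶠ k in atTop, |t k| ≤ t₀) (hx : Summable fun k => Real.exp (-x k)) (N : ℕ → ℕ) :
    ∀ᵐ ω ∂P, ∀ᶠ k in atTop, ∀ n ≤ N k,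
      |t k * ∑ i ∈ Finset.range (n + 1), Y i ω| <
        x k + t k ^ 2 * ∑ i ∈ Finset.range (n + 1), V i ω := by
  filter_upwards [ae_eventually_forall_sum_lt hYV hind ht hx N,
    ae_eventually_forall_sum_lt (t := -t) hYV hind (by simpa using ht) hx N] with ω hpos hneg
  filter_upwards [hpos, hneg] with k hpos hneg n hn
  specialize hpos n hn
  specialize hneg n hn
  simp only [Pi.neg_apply, Finset.sum_sub_distrib, ← Finset.mul_sum] at hpos hneg
  rw [neg_sq] at hneg
  rw [abs_lt]
  constructor <;> linarith

/-- The rate `√(log log n / n)` of the law of the iterated logarithm. -/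
noncomputable def lilRate (n : ℕ) : ℝ :=
  √(Real.log (Real.log n) / n)

theorem summable_exp_neg_two_mul_log : Summable fun k : ℕ => Real.exp (-(2 * Real.log k)) := by
  refine (Real.summable_nat_pow_inv.2 one_lt_two).congr_atTop ?_
  filter_upwards [eventually_gt_atTop 0] with k hk
  have hk' : (0 : ℝ) < k := Nat.cast_pos.2 hk
  rw [Real.exp_neg, mul_comm, Real.exp_mul, Real.exp_log hk', Real.rpow_two]

theorem tendsto_log_div_exp_natCast :
    Tendsto (fun k : ℕ => Real.log k / Real.exp k) atTop (𝓝 0) :=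
  (Real.isLittleO_log_id_atTop.trans
    (Real.isLittleO_pow_exp_atTop.congr_left pow_one)).tendsto_div_nhds_zero.comp
      tendsto_natCast_atTop_atTop

theorem abs_le_mul_sqrt_of_abs_sqrt_div_mul_le {L E D s : ℝ} (hL : 0 < L) (hE : 0 < E)
    (h : |√(L / E) * s| ≤ D * L) : |s| ≤ D * √(L * E) := by
  have hsqrt : √(L / E) * √(L * E) = L := by
    rw [← Real.sqrt_mul (by positivity), show L / E * (L * E) = L ^ 2 by field_simp,
      Real.sqrt_sq hL.le]
  have hpos : 0 < √(L / E) := by positivity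
  rw [abs_mul, abs_of_pos hpos] at h
  refine le_of_mul_le_mul_left (h.trans_eq ?_) hpos
  rw [mul_left_comm, hsqrt]

theorem abs_div_le_mul_lilRate {n k : ℕ} (hk : 1 < k) (hkn : ⌊Real.log n⌋₊ = k) {B s w : ℝ}
    (hB : 0 ≤ B) (hw : w ≤ B * n)
    (hs : |√(Real.log k / Real.exp k) * s| ≤
      2 * Real.log k + √(Real.log k / Real.exp k) ^ 2 * w) :
    |s / n| ≤ (2 + B * Real.exp 1) * lilRate n := by
  have hL : 0 < Real.log k := Real.log_pos (Nat.one_lt_cast.2 hk)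
  have hlog : (k : ℝ) ≤ Real.log n ∧ Real.log n < k + 1 :=
    (Nat.floor_eq_iff' (by omega)).1 hkn
  have hn : (0 : ℝ) < n := by
    have hlogpos : 0 < Real.log n := lt_of_lt_of_le (by positivity) hlog.1
    exact Nat.cast_pos.2 (Nat.pos_of_ne_zero fun h => by simp [h] at hlogpos)
  have hexp_le : Real.exp k ≤ n := (Real.le_log_iff_exp_le hn).1 hlog.1
  have hle_exp : n ≤ Real.exp k * Real.exp 1 := by
    rw [← Real.exp_add]
    exact ((Real.log_lt_iff_lt_exp hn).1 hlog.2).le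
  have hvar : √(Real.log k / Real.exp k) ^ 2 * w ≤ B * Real.exp 1 * Real.log k := by
    rw [Real.sq_sqrt (by positivity)]
    calc Real.log k / Real.exp k * w
        ≤ Real.log k / Real.exp k * (B * (Real.exp k * Real.exp 1)) := by
          gcongr
          exact hw.trans (by gcongr)
      _ = B * Real.exp 1 * Real.log k := by field_simp
  have hs' : |s| ≤ (2 + B * Real.exp 1) * √(Real.log k * Real.exp k) :=
    abs_le_mul_sqrt_of_abs_sqrt_div_mul_le hL (Real.exp_pos _) (by linarith)
  rw [abs_div, abs_of_pos hn, div_le_iff₀ hn, mul_assoc]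
  refine hs'.trans ?_
  gcongr
  calc √(Real.log k * Real.exp k) ≤ √(Real.log (Real.log n) / n * n ^ 2) := by
        refine Real.sqrt_le_sqrt ?_
        rw [div_mul_eq_mul_div, sq, ← mul_assoc, mul_div_cancel_right₀ _ hn.ne']
        have hLL : Real.log k ≤ Real.log (Real.log n) :=
          Real.log_le_log (by positivity) hlog.1
        exact mul_le_mul hLL hexp_le (Real.exp_pos _).le (hL.le.trans hLL)
    _ = lilRate n * n := by rw [Real.sqrt_mul' _ (sq_nonneg _), Real.sqrt_sq hn.le, lilRate]

theorem isBigO_lilRate_of_blocks {S W : ℕ → ℝ} (hW : W =O[atTop] fun n : ℕ => (n : ℝ))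
    (hS : ∀ᶠ k : ℕ in atTop, ∀ n ≤ ⌊Real.exp (k + 1)⌋₊,
      |√(Real.log k / Real.exp k) * S (n + 1)| <
        2 * Real.log k + √(Real.log k / Real.exp k) ^ 2 * W (n + 1)) :
    (fun n : ℕ => S n / n) =O[atTop] lilRate := by
  obtain ⟨B, hB, hWB⟩ := hW.exists_nonneg
  have hblock : Tendsto (fun n : ℕ => ⌊Real.log n⌋₊) atTop atTop :=
    tendsto_nat_floor_atTop.comp (Real.tendsto_log_atTop.comp tendsto_natCast_atTop_atTop)
  refine IsBigO.of_bound (2 + B * Real.exp 1) ?_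
  filter_upwards [hblock.eventually hS, hblock.eventually_gt_atTop 1, hWB.bound,
    eventually_gt_atTop 0] with n hSn hk hWn hn
  have hlt : (n : ℝ) < Real.exp (⌊Real.log n⌋₊ + 1) :=
    (Real.log_lt_iff_lt_exp (Nat.cast_pos.2 hn)).1 (Nat.lt_floor_add_one _)
  have hmem : n - 1 ≤ ⌊Real.exp (⌊Real.log n⌋₊ + 1)⌋₊ :=
    (Nat.sub_le n 1).trans (Nat.le_floor hlt.le)
  have hbound := (hSn (n - 1) hmem).le
  rw [Nat.sub_add_cancel hn] at hbound
  rw [Real.norm_natCast] at hWn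
  have hrate : 0 ≤ lilRate n := Real.sqrt_nonneg _
  rw [Real.norm_of_nonneg hrate]
  exact abs_div_le_mul_lilRate hk rfl hB ((le_abs_self _).trans hWn) hbound

theorem ae_isBigO_lilRate (ht₀ : 0 < t₀) (hYV : ∀ i, IsCanonicalPair P t₀ (Y i) (V i))
    (hind : iIndepFun (fun i ω => (Y i ω, V i ω)) P)
    (hV : ∀ᵐ ω ∂P, (fun n : ℕ => ∑ i ∈ Finset.range n, V i ω) =O[atTop] fun n : ℕ => (n : ℝ)) :
    ∀ᵐ ω ∂P, (fun n : ℕ => (∑ i ∈ Finset.range n, Y i ω) / n) =O[atTop] lilRate := by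
  have ht : Tendsto (fun k : ℕ => |√(Real.log k / Real.exp k)|) atTop (𝓝 0) := by
    simpa using tendsto_log_div_exp_natCast.sqrt.abs
  filter_upwards [hV, ae_eventually_forall_abs_mul_sum_lt hYV hind (ht.eventually_le_const ht₀)
    summable_exp_neg_two_mul_log fun k => ⌊Real.exp (k + 1)⌋₊] with ω hVω hω
  exact isBigO_lilRate_of_blocks hVω hω

theorem eventually_pos_log_log : ∀ᶠ n : ℕ in atTop, 0 < Real.log (Real.log n) :=
  (Real.tendsto_log_atTop.comp (Real.tendsto_log_atTop.comp
    tendsto_natCast_atTop_atTop)).eventually_gt_atTop 0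

theorem tendsto_lilRate : Tendsto lilRate atTop (𝓝 0) := by
  have hlog : (fun n : ℕ => Real.log (Real.log n)) =o[atTop] fun n : ℕ => (n : ℝ) :=
    ((Real.isLittleO_log_id_atTop.comp_tendsto Real.tendsto_log_atTop).trans
      Real.isLittleO_log_id_atTop).comp_tendsto tendsto_natCast_atTop_atTop
  unfold lilRate
  simpa only [Real.sqrt_zero] using hlog.tendsto_div_nhds_zero.sqrt

theorem natCast_mul_lilRate_sq :
    (fun n : ℕ => n * lilRate n ^ 2) =ᶠ[atTop] fun n : ℕ => Real.log (Real.log n) := by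
  filter_upwards [eventually_pos_log_log, eventually_gt_atTop 0] with n hlog hn
  rw [lilRate, Real.sq_sqrt (by positivity), mul_div_cancel₀ _ (by positivity)]

theorem isLittleO_of_tendsto_div_atTop {α : Type*} {l : Filter α} {f g : α → ℝ}
    (h : Tendsto (fun x => g x / f x) l atTop) : f =o[l] g := by
  refine isLittleO_of_tendsto' ?_ (h.inv_tendsto_atTop.congr fun x => inv_div _ _)
  filter_upwards [h.eventually_gt_atTop 0] with x hx hgx
  simp [hgx] at hx

theorem isLittleO_natCast_mul_sq {f C : ℕ → ℝ} (hf : f =O[atTop] lilRate)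
    (hC : (fun n : ℕ => Real.log (Real.log n)) =o[atTop] C) :
    (fun n : ℕ => n * f n ^ 2) =o[atTop] C :=
  (((isBigO_refl (fun n : ℕ => (n : ℝ)) atTop).mul (hf.pow 2)).trans_eventuallyEq
    natCast_mul_lilRate_sq).trans_isLittleO hC

end IteratedLogarithm

section GaussianCanonicalPairs

theorem lintegral_exp_mul_sub_gaussian (t : ℝ) :
    ∫⁻ x, ENNReal.ofReal (Real.exp (t * x - t ^ 2 / 2)) ∂(gaussianReal 0 1) = 1 := by
  have hint : Integrable (fun x => Real.exp (t * x) / Real.exp (t ^ 2 / 2)) (gaussianReal 0 1) :=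
    (integrable_exp_mul_gaussianReal t).div_const _
  have hmgf : ∫ x, Real.exp (t * x) ∂(gaussianReal 0 1) = Real.exp (t ^ 2 / 2) := by
    simpa [mgf] using congrFun (mgf_id_gaussianReal (μ := 0) (v := 1)) t
  simp_rw [Real.exp_sub]
  rw [← ofReal_integral_eq_lintegral_ofReal hint (ae_of_all _ fun _ => by positivity),
    integral_div, hmgf, div_self (Real.exp_ne_zero _), ENNReal.ofReal_one]

theorem inv_sqrt_mul_exp_mul_sqrt_pi_div_le_one {t : ℝ} (ht : t ≤ 1 / 4) :
    (√(2 * Real.pi))⁻¹ * Real.exp (-t - 4 * t ^ 2) * √(Real.pi / (1 / 2 - t)) ≤ 1 := by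
  have hpos : 0 < 1 - 2 * t := by linarith
  have hsqrt : (√(2 * Real.pi))⁻¹ * √(Real.pi / (1 / 2 - t)) = √((1 - 2 * t)⁻¹) := by
    rw [← Real.sqrt_inv, ← Real.sqrt_mul (by positivity)]
    congr 1
    have := hpos.ne'
    field_simp
  have hexp : Real.exp (-t - 4 * t ^ 2) = √(Real.exp (2 * t + 8 * t ^ 2))⁻¹ := by
    rw [← Real.exp_neg, ← Real.exp_half]
    ring_nf
  have hone : 1 ≤ (1 - 2 * t) * Real.exp (2 * t + 8 * t ^ 2) :=
    calc (1 : ℝ) ≤ (1 - 2 * t) * (2 * t + 8 * t ^ 2 + 1) := by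
          nlinarith [mul_nonneg (sq_nonneg t) (sub_nonneg.2 ht)]
      _ ≤ (1 - 2 * t) * Real.exp (2 * t + 8 * t ^ 2) := by
          gcongr
          exact Real.add_one_le_exp _
  rw [mul_right_comm, hsqrt, hexp, ← Real.sqrt_mul (by positivity), ← mul_inv, Real.sqrt_le_one]
  exact inv_le_one_of_one_le₀ hone

theorem lintegral_exp_mul_sq_sub_gaussian_le {t : ℝ} (ht : t ≤ 1 / 4) :
    ∫⁻ x, ENNReal.ofReal (Real.exp (t * (x ^ 2 - 1) - t ^ 2 * 4)) ∂(gaussianReal 0 1) ≤ 1 := by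
  have hb : 0 < 1 / 2 - t := by linarith
  have hdensity (x : ℝ) : (gaussianPDF 0 1 * fun x =>
      ENNReal.ofReal (Real.exp (t * (x ^ 2 - 1) - t ^ 2 * 4))) x =
      ENNReal.ofReal ((√(2 * Real.pi))⁻¹ * Real.exp (-t - 4 * t ^ 2) *
        Real.exp (-(1 / 2 - t) * x ^ 2)) := by
    rw [Pi.mul_apply, gaussianPDF, ← ENNReal.ofReal_mul (gaussianPDFReal_nonneg _ _ _),
      gaussianPDFReal]
    simp only [NNReal.coe_one, mul_one, sub_zero, mul_assoc, ← Real.exp_add]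
    ring_nf
  rw [gaussianReal_of_var_ne_zero 0 one_ne_zero,
    lintegral_withDensity_eq_lintegral_mul _ (measurable_gaussianPDF 0 1) (by fun_prop)]
  simp_rw [hdensity]
  rw [← ofReal_integral_eq_lintegral_ofReal ((integrable_exp_neg_mul_sq hb).const_mul _)
    (ae_of_all _ fun _ => by positivity), integral_const_mul, integral_gaussian,
    ENNReal.ofReal_le_one]
  exact inv_sqrt_mul_exp_mul_sqrt_pi_div_le_one ht

variable {Ω : Type*} [MeasurableSpace Ω] {P : Measure Ω} {U G : Ω → ℝ}

theorem lintegral_exp_mul_mul_sub_eq_one [IsProbabilityMeasure P] (hU : AEMeasurable U P)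
    (hG : HasLaw G (gaussianReal 0 1) P) (hUG : IndepFun U G P) (t : ℝ) :
    ∫⁻ ω, ENNReal.ofReal (Real.exp (t * U ω * G ω - (t * U ω) ^ 2 / 2)) ∂P = 1 := by
  have hmap := (indepFun_iff_map_prod_eq_prod_map_map hU hG.aemeasurable).1 hUG
  have : IsProbabilityMeasure (P.map U) := Measure.isProbabilityMeasure_map hU
  calc ∫⁻ ω, ENNReal.ofReal (Real.exp (t * U ω * G ω - (t * U ω) ^ 2 / 2)) ∂P
      = ∫⁻ x : ℝ × ℝ, ENNReal.ofReal (Real.exp (t * x.1 * x.2 - (t * x.1) ^ 2 / 2))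
          ∂((P.map U).prod (P.map G)) := by
        rw [← hmap, lintegral_map' (by fun_prop) (hU.prodMk hG.aemeasurable)]
    _ = ∫⁻ u, ∫⁻ g, ENNReal.ofReal (Real.exp (t * u * g - (t * u) ^ 2 / 2))
          ∂(gaussianReal 0 1) ∂(P.map U) := by
        rw [hG.map_eq, lintegral_prod _ (by fun_prop)]
    _ = 1 := by simp [lintegral_exp_mul_sub_gaussian]

theorem isCanonicalPair_mul_gaussian [IsProbabilityMeasure P] (hU : AEMeasurable U P)
    (hG : HasLaw G (gaussianReal 0 1) P) (hUG : IndepFun U G P) (t₀ : ℝ) :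
    IsCanonicalPair P t₀ (fun ω => U ω * G ω) fun ω => U ω ^ 2 where
  aemeasurable_fst := hU.mul hG.aemeasurable
  aemeasurable_snd := hU.pow_const 2
  lintegral_exp_le_one t _ := by
    rw [← lintegral_exp_mul_mul_sub_eq_one hU hG hUG t]
    refine lintegral_mono fun ω => ENNReal.ofReal_le_ofReal (Real.exp_le_exp.2 ?_)
    nlinarith [sq_nonneg (t * U ω)]

theorem isCanonicalPair_gaussian_sq_sub_one (hG : HasLaw G (gaussianReal 0 1) P) :
    IsCanonicalPair P (1 / 4) (fun ω => G ω ^ 2 - 1) fun _ => 4 where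
  aemeasurable_fst := (hG.aemeasurable.pow_const 2).sub_const 1
  aemeasurable_snd := aemeasurable_const
  lintegral_exp_le_one t ht := by
    rw [hG.lintegral_comp
      (f := fun x => ENNReal.ofReal (Real.exp (t * (x ^ 2 - 1) - t ^ 2 * 4))) (by fun_prop)]
    exact lintegral_exp_mul_sq_sub_gaussian_le (le_of_abs_le ht)

end GaussianCanonicalPairs

section ProductLaw

variable {Ω ι : Type*} [MeasurableSpace Ω] {P : Measure Ω} [Fintype ι] {E : ι → Type*}
  [∀ i, MeasurableSpace (E i)] {μ : ∀ i, Measure (E i)} [∀ i, IsProbabilityMeasure (μ i)]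
  {G : Ω → ∀ i, E i}

theorem hasLaw_apply_of_hasLaw_pi (hG : HasLaw G (Measure.pi μ) P) (i : ι) :
    HasLaw (fun ω => G ω i) (μ i) P :=
  (measurePreserving_eval μ i).hasLaw.comp hG

theorem iIndepFun_apply_of_hasLaw_pi [IsProbabilityMeasure P] (hG : HasLaw G (Measure.pi μ) P) :
    iIndepFun (fun i ω => G ω i) P :=
  (iIndepFun_iff_hasLaw_pi_pi (hasLaw_apply_of_hasLaw_pi hG)).2 hG

theorem memLp_apply_of_hasLaw_pi_gaussianReal {G : Ω → ι → ℝ}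
    (hG : HasLaw G (Measure.pi fun _ => gaussianReal 0 1) P) (r : NNReal) (i : ι) :
    MemLp (fun ω => G ω i) r P := by
  have hGi := hasLaw_apply_of_hasLaw_pi hG i
  have hid := memLp_id_gaussianReal (μ := 0) (v := 1) r
  rw [← hGi.map_eq] at hid
  exact (memLp_map_measure_iff aestronglyMeasurable_id hGi.aemeasurable).1 hid

end ProductLaw

section Model

open Asymptotics

variable {Ω : Type*} [MeasurableSpace Ω] {P : Measure Ω} {p q : ℕ}
  {s : ℕ → Ω → Fin q → ℝ} {z : ℕ → Ω → Fin p → ℝ}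

theorem ae_tendsto_sampleCov (h_indep : iIndepFun s P)
    (h_ident : ∀ i, IdentDistrib (s i) (s 0) P P)
    (h_memLp : ∀ a, MemLp (fun ω => s 0 ω a) 2 P) :
    ∀ᵐ ω ∂P, Tendsto (sampleCov fun i => s i ω) atTop (𝓝 (secondMoment P (s 0))) := by
  have hentry (a a' : Fin q) : ∀ᵐ ω ∂P,
      Tendsto (fun n : ℕ => (∑ i ∈ Finset.range n, s i ω a * s i ω a') / n) atTop
        (𝓝 (secondMoment P (s 0) a a')) := by
    have hmeas : Measurable fun v : Fin q → ℝ => v a * v a' := by fun_prop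
    exact strong_law_ae_real (fun i ω => s i ω a * s i ω a')
      ((h_memLp a).integrable_mul (h_memLp a'))
      (fun i j hij => (h_indep.indepFun hij).comp hmeas hmeas) fun i => (h_ident i).comp hmeas
  filter_upwards [ae_all_iff.2 fun a => ae_all_iff.2 (hentry a)] with ω hω
  refine tendsto_pi_nhds.2 fun a => tendsto_pi_nhds.2 fun a' => ?_
  simpa only [sampleCov_apply] using hω a a'

theorem ae_isBigO_sampleCrossMoment [IsProbabilityMeasure P]
    (h_indep : iIndepFun (fun (i : ℕ) (ω : Ω) => (s i ω, z i ω)) P)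
    (h_ident : ∀ i, IdentDistrib (s i) (s 0) P P)
    (h_memLp : ∀ a, MemLp (fun ω => s 0 ω a) 2 P)
    (h_noise : ∀ i, HasLaw (z i) (Measure.pi fun _ : Fin p => gaussianReal 0 1) P)
    {a : Fin q} {b : Fin p} (hab : ∀ i, IndepFun (fun ω => s i ω a) (fun ω => z i ω b) P) :
    ∀ᵐ ω ∂P, (fun n => sampleCrossMoment (fun i => s i ω) (fun i => z i ω) n a b)
      =O[atTop] lilRate := by
  have hs (i : ℕ) : AEMeasurable (fun ω => s i ω a) P :=
    (measurable_pi_apply a).comp_aemeasurable (h_ident i).aemeasurable_fst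
  simp_rw [sampleCrossMoment_apply]
  refine ae_isBigO_lilRate one_pos
    (fun i => isCanonicalPair_mul_gaussian (hs i) (hasLaw_apply_of_hasLaw_pi (h_noise i) b)
      (hab i) 1)
    (h_indep.comp (fun _ v => (v.1 a * v.2 b, v.1 a ^ 2)) fun _ => by fun_prop) ?_
  filter_upwards [ae_tendsto_sampleCov (h_indep.comp (fun _ v => v.1) fun _ => measurable_fst)
    h_ident h_memLp] with ω hω
  have hdiag := tendsto_pi_nhds.1 (tendsto_pi_nhds.1 hω a) a
  have hO := (hdiag.isBigO_one ℝ).mul (isBigO_refl (fun n : ℕ => (n : ℝ)) atTop)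
  simp only [one_mul] at hO
  refine hO.congr' ?_ EventuallyEq.rfl
  filter_upwards [eventually_gt_atTop 0] with n hn
  simp only [sampleCov_apply, Function.comp_apply, sq]
  field_simp

theorem ae_isBigO_sampleCov_sub_one [IsProbabilityMeasure P] (h_indep : iIndepFun z P)
    (h_noise : ∀ i, HasLaw (z i) (Measure.pi fun _ : Fin p => gaussianReal 0 1) P)
    (b b' : Fin p) :
    ∀ᵐ ω ∂P, (fun n => (sampleCov (fun i => z i ω) n - 1) b b') =O[atTop] lilRate := by
  obtain rfl | hne := eq_or_ne b b'
  · have hlil := ae_isBigO_lilRate (by norm_num : (0 : ℝ) < 1 / 4)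
      (fun i => isCanonicalPair_gaussian_sq_sub_one (hasLaw_apply_of_hasLaw_pi (h_noise i) b))
      (h_indep.comp (fun _ v => (v b ^ 2 - 1, (4 : ℝ))) fun _ => by fun_prop)
      (ae_of_all _ fun _ => by
        simpa [mul_comm] using isBigO_const_mul_self (4 : ℝ) (fun n : ℕ => (n : ℝ)) atTop)
    filter_upwards [hlil] with ω hω
    refine hω.congr' ?_ EventuallyEq.rfl
    filter_upwards [eventually_gt_atTop 0] with n hn
    simp only [Matrix.sub_apply, Matrix.one_apply_eq, sampleCov_apply, sq,
      Finset.sum_sub_distrib, Finset.sum_const, Finset.card_range, nsmul_eq_mul, mul_one]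
    field_simp
  · have hcross := ae_isBigO_sampleCrossMoment
      (h_indep.comp (fun _ v => (v, v)) fun _ => by fun_prop)
      (fun i => ⟨(h_noise i).aemeasurable, (h_noise 0).aemeasurable,
        (h_noise i).map_eq.trans (h_noise 0).map_eq.symm⟩)
      (memLp_apply_of_hasLaw_pi_gaussianReal (h_noise 0) 2) h_noise
      fun i => (iIndepFun_apply_of_hasLaw_pi (h_noise i)).indepFun hne
    filter_upwards [hcross] with ω hω
    simpa [sampleCrossMoment_apply, sampleCov_apply, hne] using hω

theorem ae_isBigO_noiseError [IsProbabilityMeasure P]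
    (h_indep : iIndepFun (fun (i : ℕ) (ω : Ω) => (s i ω, z i ω)) P)
    (h_signal_noise : ∀ i, IndepFun (s i) (z i) P)
    (h_ident : ∀ i, IdentDistrib (s i) (s 0) P P)
    (h_memLp : ∀ a, MemLp (fun ω => s 0 ω a) 2 P)
    (h_noise : ∀ i, HasLaw (z i) (Measure.pi fun _ : Fin p => gaussianReal 0 1) P)
    (M : Matrix (Fin p) (Fin q) ℝ) (σ : ℝ) :
    ∀ᵐ ω ∂P, ∀ a b, (fun n => noiseError M σ (fun i => s i ω) (fun i => z i ω) n a b)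
      =O[atTop] lilRate := by
  have hcross := ae_all_iff.2 fun a => ae_all_iff.2 fun b =>
    ae_isBigO_sampleCrossMoment h_indep h_ident h_memLp h_noise fun i =>
      (h_signal_noise i).comp (measurable_pi_apply a) (measurable_pi_apply b)
  have hnoise := ae_all_iff.2 fun b => ae_all_iff.2 fun b' =>
    ae_isBigO_sampleCov_sub_one (h_indep.comp (fun _ v => v.2) fun _ => measurable_snd)
      h_noise b b'
  filter_upwards [hcross, hnoise] with ω hcross hnoise
  exact isBigO_noiseError hcross hnoise

theorem tendsto_rank_of_IC_le {M : Matrix (Fin p) (Fin q) ℝ} {Γ : Matrix (Fin q) (Fin q) ℝ}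
    {σ : ℝ} {s : ℕ → Fin q → ℝ} {z : ℕ → Fin p → ℝ} (hσ : 0 < σ) (hΓ : Γ.PosDef)
    (hs : Tendsto (sampleCov s) atTop (𝓝 Γ))
    (herror : ∀ a b, (fun n => noiseError M σ s z n a b) =O[atTop] lilRate)
    {C : ℕ → ℝ} (hC_upper : Tendsto (fun n : ℕ => C n / (n : ℝ)) atTop (𝓝 0))
    (hC_lower : Tendsto (fun n : ℕ => C n / Real.log (Real.log (n : ℝ))) atTop atTop)
    {K : Finset ℕ} (hK : ∀ k ∈ K, k ≤ p) (hpK : M.rank + 1 = p → p ∉ K)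
    {khat : ℕ → ℕ} (h_mem : ∀ n, khat n ∈ K)
    (h_min : ∀ n, IC σ (C n) (fun i => observation M σ (s i) (z i)) n (khat n) ≤
      IC σ (C n) (fun i => observation M σ (s i) (z i)) n M.rank) :
    Tendsto khat atTop (𝓝 M.rank) := by
  have hC_pos : ∀ᶠ n in atTop, 0 < C n := by
    filter_upwards [hC_lower.eventually_gt_atTop 0, eventually_pos_log_log] with n hC hlog
    exact (div_pos_iff_of_pos_right hlog).1 hC
  have herror_zero : Tendsto (noiseError M σ s z) atTop (𝓝 0) :=
    tendsto_pi_nhds.2 fun a => tendsto_pi_nhds.2 fun b => (herror a b).trans_tendsto tendsto_lilRate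
  refine tendsto_of_eventually_lt_of_forall_le h_mem h_min fun k hk hne => ?_
  rcases hne.lt_or_gt with hlt | hgt
  · have hkp : k < p := hlt.trans_le M.rank_le_height
    obtain ⟨l, hl, hlim⟩ := exists_tendsto_sampleEig_of_lt_rank (i := ⟨k, hkp⟩) hσ.le hΓ hs
      herror_zero hlt
    exact eventually_IC_lt_of_lt_of_tendsto hσ hlt hkp hl.ne' hlim hC_upper
  · refine eventually_IC_lt_of_gt_of_isLittleO hgt (hK k hk) (fun h => hpK h.1 (h.2 ▸ hk))
      (fun i hi => ?_) hC_pos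
    exact isLittleO_natCast_mul_sq (isBigO_sampleEig_sub_of_rank_le hσ.le herror hi)
      (isLittleO_of_tendsto_div_atTop hC_lower)

end Model

theorem theorem2_general {Ω : Type*} [MeasurableSpace Ω] (P : Measure Ω) [IsProbabilityMeasure P]
    (p q : ℕ) (M : Matrix (Fin p) (Fin q) ℝ)
    (σ : ℝ) (hσ : 0 < σ)
    (s : ℕ → Ω → Fin q → ℝ) (z : ℕ → Ω → Fin p → ℝ)
    (h_indep : iIndepFun (fun (i : ℕ) (ω : Ω) => (s i ω, z i ω)) P)
    (h_signal_noise : ∀ i, IndepFun (s i) (z i) P)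
    (h_ident : ∀ i, IdentDistrib (s i) (s 0) P P)
    (h_memLp : ∀ a, MemLp (fun ω => s 0 ω a) 2 P)
    (h_cov : (secondMoment P (s 0)).PosDef)
    (h_noise : ∀ i, HasLaw (z i) (Measure.pi fun _ : Fin p => gaussianReal 0 1) P)
    (C : ℕ → ℝ)
    (hC_upper : Tendsto (fun n : ℕ => C n / (n : ℝ)) atTop (𝓝 0))
    (hC_lower : Tendsto (fun n : ℕ => C n / Real.log (Real.log (n : ℝ))) atTop atTop)
    (K : Finset ℕ) (hK : ∀ k ∈ K, k ≤ p) (hrK : M.rank ∈ K) (hpK : M.rank + 1 = p → p ∉ K)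
    (khat : ℕ → Ω → ℕ)
    (h_mem : ∀ n ω, khat n ω ∈ K)
    (h_min : ∀ n ω, ∀ k ∈ K,
      IC σ (C n) (fun i => observation M σ (s i ω) (z i ω)) n (khat n ω) ≤
        IC σ (C n) (fun i => observation M σ (s i ω) (z i ω)) n k) :
    ∀ᵐ ω ∂P, Tendsto (fun n => khat n ω) atTop (𝓝 M.rank) := by
  have hcov := ae_tendsto_sampleCov (h_indep.comp (fun _ v => v.1) fun _ => measurable_fst)
    h_ident h_memLp
  have herror := ae_isBigO_noiseError h_indep h_signal_noise h_ident h_memLp h_noise M σ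
  filter_upwards [hcov, herror] with ω hcov herror
  exact tendsto_rank_of_IC_le hσ h_cov hcov herror hC_upper hC_lower hK hpK
    (fun n => h_mem n ω) fun n => h_min n ω M.rank hrK

theorem theorem2 {Ω : Type*} [MeasurableSpace Ω] (P : Measure Ω) [IsProbabilityMeasure P]
    (p q : ℕ) (M : Matrix (Fin p) (Fin q) ℝ) (hM : LinearIndependent ℝ M.col)
    (σ : ℝ) (hσ : 0 < σ)
    (s : ℕ → Ω → Fin q → ℝ) (z : ℕ → Ω → Fin p → ℝ)
    (h_indep : iIndepFun (fun (i : ℕ) (ω : Ω) => (s i ω, z i ω)) P)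
    (h_signal_noise : ∀ i, IndepFun (s i) (z i) P)
    (h_ident : ∀ i, IdentDistrib (s i) (s 0) P P)
    (h_memLp : ∀ a, MemLp (fun ω => s 0 ω a) 2 P)
    (h_mean : ∀ a, ∫ ω, s 0 ω a ∂P = 0)
    (h_cov : (secondMoment P (s 0)).PosDef)
    (h_noise : ∀ i, HasLaw (z i) (Measure.pi fun _ : Fin p => gaussianReal 0 1) P)
    (C : ℕ → ℝ)
    (hC_upper : Tendsto (fun n : ℕ => C n / (n : ℝ)) atTop (𝓝 0))
    (hC_lower : Tendsto (fun n : ℕ => C n / Real.log (Real.log (n : ℝ))) atTop atTop)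
    (K : Finset ℕ) (hK : ∀ k ∈ K, k ≤ p) (hqK : q ∈ K) (hpK : q + 1 = p → p ∉ K)
    (khat : ℕ → Ω → ℕ)
    (h_mem : ∀ n ω, khat n ω ∈ K)
    (h_min : ∀ n ω, ∀ k ∈ K,
      IC σ (C n) (fun i => observation M σ (s i ω) (z i ω)) n (khat n ω) ≤
        IC σ (C n) (fun i => observation M σ (s i ω) (z i ω)) n k) :
    ∀ᵐ ω ∂P, Tendsto (fun n => khat n ω) atTop (𝓝 q) := by
  have hrank : M.rank = q := by simpa using hM.rank_matrix (M := M.transpose)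
  rw [← hrank] at hqK hpK ⊢
  exact theorem2_general P p q M σ hσ s z h_indep h_signal_noise h_ident h_memLp h_cov h_noise
    C hC_upper hC_lower K hK hqK hpK khat h_mem h_min
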